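/- A (small) \emph{constellation} is a set $Q$ with a partial binary operation $\cdot$ such that: (1) if $x\cdot(y\cdot z)$ exists then $(x\cdot y)\cdot z$ exists and the two are equal; (2) if $x\cdot y$ and $y\cdot z$ exist then so does $x\cdot(y\cdot z)$; (3) for each $x\in Q$ there is a unique right identity $e$ (an element such that $y\cdot e=y$ whenever $y\cdot e$ exists) with $e\cdot x=x$; this $e$ is denoted $D(x)$. Put $D(Q)=\{D(x): x\in Q\}$, the set of projections. The natural order is given by $s\le t$ if and only if $s=e\cdot t$ for some $e\in D(Q)$. The constellation is \emph{D-inverse} if for every $s\in Q$ there is a unique $t\in Q$ with $s\cdot t=D(s)$ and $t\cdot s=D(t)$. A \emph{radiant} $\rho:P\to Q$ is a map such that whenever $s\cdot t$ exists so does $s\rho\cdot t\rho$, with $(s\cdot t)\rho=s\rho\cdot t\rho$, and such that $D(s\rho)=D(s)\rho$ for all $s$. Let $\mathbf{C}$ be the category whose objects are the small D-inverse constellations $Q$ in which $D(Q)$ is a meet-semilattice under the natural order, and whose arrows are the radiants that preserve binary meets of projections. Let $\mathbf{I}$ be the category of inverse semigroups (semigroups in which every $a$ has a unique $a'$ with $a=aa'a$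 and $a'=a'aa'$) and semigroup morphisms. Theorem. The categories $\mathbf{C}$ and $\mathbf{I}$ are isomorphic. More precisely, there is an isomorphism of categories $\mathbf{I}\to\mathbf{C}$ that is the identity on underlying sets and on underlying maps, and that sends an inverse semigroup $S$ to the constellation on the set $S$ in which $s\cdot t$ exists if and only if $stt'=s$, and then $s\cdot t=st$. -/

import Mathlib

open CategoryTheory

universe u

/-- `e` is a right identity for a partial binary operation: whenever `x · e` exists,
it equals `x`.  Here `z ∈ mul x y` means: `x · y` exists and equals `z`. -/
def IsRightIdentity {Q : Type u} (mul : Q → Q → Part Q) (e : Q) : Prop :=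
  ∀ x z : Q, z ∈ mul x e → z = x

/-- A (small) constellation: a set with a partial binary operation satisfying the laws
(Const1), (Const2) and (Const3). -/
@[ext]
class Constellation (Q : Type u) where
  /-- the partial product -/
  mul : Q → Q → Part Q
  /-- If `x · (y · z)` exists, then so does `(x · y) · z`, and the two are equal. -/
  const1 : ∀ x y z a w : Q, a ∈ mul y z → w ∈ mul x a → ∃ b : Q, b ∈ mul x y ∧ w ∈ mul b z
  /-- If `x · y` and `y · z` exist, then so does `x · (y · z)`. -/
  const2 : ∀ x y z a b : Q, a ∈ mul x y → b ∈ mul y z → (mul x b).Dom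
  /-- For each `x` there is a unique right identity `e` with `e · x = x`. -/
  const3 : ∀ x : Q, ∃! e : Q, IsRightIdentity mul e ∧ x ∈ mul e x

namespace Constellation

section Basic

variable {Q : Type u} [Constellation Q]

/-- The domain `D(x)`: the unique right identity `e` with `e · x = x`. -/
noncomputable def D (x : Q) : Q := (const3 x).choose

/-- `D(x)` is a right identity, and `D(x) · x = x`. -/
theorem D_spec (x : Q) : IsRightIdentity (mul (Q := Q)) (D x) ∧ x ∈ mul (D x) x :=
  (const3 x).choose_spec.1

/-- `D(x)` is the only right identity `e` with `e · x = x`. -/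
theorem eq_D (x e : Q) (h : IsRightIdentity (mul (Q := Q)) e) (hx : x ∈ mul e x) : e = D x :=
  (const3 x).choose_spec.2 e ⟨h, hx⟩

variable (Q) in
/-- The set `D(Q)` of projections. -/
def projections : Set Q := Set.range (D (Q := Q))

/-- The natural quasiorder: `s ≤ t` iff `s = e · t` for some projection `e`. -/
def NaturalLE (s t : Q) : Prop := ∃ e ∈ projections Q, s ∈ mul e t

/-- `t` is a D-inverse of `s`: `s · t = D(s)` and `t · s = D(t)`. -/
def IsDInverse (s t : Q) : Prop := D s ∈ mul s t ∧ D t ∈ mul t s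

variable (Q) in
/-- The constellation is D-inverse: every element has a unique D-inverse. -/
def DInverse : Prop := ∀ s : Q, ∃! t : Q, IsDInverse s t

variable (Q) in
/-- The projections form a meet-semilattice under the natural order. -/
def ProjectionsMeetSemilattice : Prop :=
  ∃ L : SemilatticeInf (projections Q), ∀ e f : projections Q, L.le e f ↔ NaturalLE e.1 f.1

/-- The projection `g` is the meet (greatest lower bound) of `e` and `f` among the projections,
under the natural order. -/
def IsMeet (e f g : Q) : Prop :=
  g ∈ projections Q ∧ NaturalLE g e ∧ NaturalLE g f ∧
    ∀ h ∈ projections Q, NaturalLE h e → NaturalLE h f → NaturalLE h g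

end Basic

/-- A radiant: a map `ρ` such that if `s · t` exists then so does `sρ · tρ` and equals
`(s · t)ρ`, and such that `D(sρ) = D(s)ρ`. -/
structure Radiant (P Q : Type u) [Constellation P] [Constellation Q] where
  /-- the underlying map -/
  toFun : P → Q
  map_mul' : ∀ s t z : P, z ∈ mul s t → toFun z ∈ mul (toFun s) (toFun t)
  map_D' : ∀ s : P, D (toFun s) = toFun (D s)

/-- A radiant that preserves binary meets of projections. -/
structure MeetRadiant (P Q : Type u) [Constellation P] [Constellation Q]
    extends Radiant P Q where
  map_meet' : ∀ e ∈ projections P, ∀ f ∈ projections P, ∀ g : P,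
    IsMeet e f g → IsMeet (toFun e) (toFun f) (toFun g)

instance {P Q : Type u} [Constellation P] [Constellation Q] : FunLike (MeetRadiant P Q) P Q where
  coe ρ := ρ.toFun
  coe_injective := by
    rintro ⟨⟨f, _, _⟩, _⟩ ⟨⟨g, _, _⟩, _⟩ h
    cases h
    rfl

/-- The identity as a meet-preserving radiant. -/
def MeetRadiant.id (P : Type u) [Constellation P] : MeetRadiant P P where
  toFun x := x
  map_mul' _ _ _ h := h
  map_D' _ := rfl
  map_meet' _ _ _ _ _ h := h

/-- Composition, first `ρ` and then `σ`. -/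
def MeetRadiant.comp {P Q R : Type u} [Constellation P] [Constellation Q] [Constellation R]
    (ρ : MeetRadiant P Q) (σ : MeetRadiant Q R) : MeetRadiant P R where
  toFun x := σ.toFun (ρ.toFun x)
  map_mul' s t z h := σ.map_mul' _ _ _ (ρ.map_mul' s t z h)
  map_D' s := by rw [σ.map_D', ρ.map_D']
  map_meet' := by
    rintro _ ⟨e, rfl⟩ _ ⟨f, rfl⟩ g h
    exact σ.map_meet' _ ⟨ρ.toFun e, ρ.map_D' e⟩ _ ⟨ρ.toFun f, ρ.map_D' f⟩ _
      (ρ.map_meet' _ ⟨e, rfl⟩ _ ⟨f, rfl⟩ g h)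

end Constellation

/-- Small D-inverse constellations whose projections form a meet-semilattice under the
natural order. -/
structure MeetDInvConst : Type (u + 1) where
  /-- the underlying set -/
  carrier : Type u
  /-- the constellation structure -/
  [str : Constellation carrier]
  dInverse : Constellation.DInverse carrier
  meets : Constellation.ProjectionsMeetSemilattice carrier

namespace MeetDInvConst

instance : CoeSort MeetDInvConst.{u} (Type u) := ⟨carrier⟩

attribute [instance] MeetDInvConst.str

/-- An arrow in the category of these constellations: a meet-preserving radiant. -/
@[ext]
structure Hom (P Q : MeetDInvConst.{u}) where
  /-- the underlying meet-preserving radiant -/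
  hom : Constellation.MeetRadiant P.carrier Q.carrier

/-- The category of these constellations, with meet-preserving radiants as arrows. -/
instance : Category MeetDInvConst.{u} where
  Hom P Q := Hom P Q
  id P := ⟨Constellation.MeetRadiant.id P.carrier⟩
  comp ρ σ := ⟨ρ.hom.comp σ.hom⟩

instance : ConcreteCategory MeetDInvConst.{u}
    (fun P Q => Constellation.MeetRadiant P.carrier Q.carrier) where
  hom ρ := ρ.hom
  ofHom ρ := ⟨ρ⟩
  id_apply _ := rfl
  comp_apply _ _ _ := rfl

end MeetDInvConst

/-- `b` is an inverse of `a` in a semigroup: `a = a b a` and `b = b a b`. -/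
def IsSemigroupInverse {S : Type u} [Semigroup S] (a b : S) : Prop :=
  a = a * b * a ∧ b = b * a * b

/-- A semigroup is inverse if every element has a unique inverse. -/
def isInverseSemigroup : ObjectProperty Semigrp.{u} :=
  fun S => ∀ a : S, ∃! b : S, IsSemigroupInverse a b

/-- The category of inverse semigroups and semigroup morphisms. -/
abbrev InvSemigrp : Type (u + 1) := isInverseSemigroup.{u}.FullSubcategory

/-! ### Inverse semigroups -/

section InverseSemigroup

variable {S : Type u} [Semigroup S]

/-! An element `s` of a constellation acts by the partial map `x ↦ x · s`, and once the projections
are partially ordered it is determined by this action (`eq_of_mul_eq`). A total product `s * t` can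
thus be pinned down by demanding that it act as the composite of the two actions (`IsProduct`);
associativity is then that of composition. Such a product exists: corestrict `s` to the meet of its
range `D s'` with `D t`, then multiply by `t` inside the constellation
(`IsRestrictedProduct.isProduct`). Idempotents of the resulting semigroup are projections, which
commute, so the semigroup is inverse. Conversely, in an inverse semigroup `s * t` acts as the
composite for the restricted product (`isProduct_ofInverse`), so uniqueness makes the two
constructions mutually inverse. Meet-preserving radiants carry along every ingredient of
`IsRestrictedProduct`, hence respect total products. -/

theorem IsSemigroupInverse.symm {a b : S} (h : IsSemigroupInverse a b) :
    IsSemigroupInverse b a := ⟨h.2, h.1⟩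

theorem isSemigroupInverse_self {e : S} (he : e * e = e) : IsSemigroupInverse e e := by
  simp [IsSemigroupInverse, he]

/-- In an inverse semigroup, idempotents have idempotent products. -/
theorem mul_idempotent_of_inverse (h : ∀ a : S, ∃! b : S, IsSemigroupInverse a b) {e f : S}
    (he : e * e = e) (hf : f * f = f) : (e * f) * (e * f) = e * f := by
  obtain ⟨x, ⟨h1, h2⟩, hx⟩ := h (e * f)
  -- `f * x * e` is again an inverse of `e * f`; this form makes `x` idempotent, hence its own
  -- inverse.
  have h3 : f * x * e = x := hx _ ⟨by grind, by grind⟩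
  have h4 : x * x = x := by grind
  have h5 : x = e * f :=
    (h x).unique (isSemigroupInverse_self h4) (IsSemigroupInverse.symm ⟨h1, h2⟩)
  rw [← h5, h4]

/-- In an inverse semigroup, idempotents commute. -/
theorem idempotent_comm_of_inverse (h : ∀ a : S, ∃! b : S, IsSemigroupInverse a b) {e f : S}
    (he : e * e = e) (hf : f * f = f) : e * f = f * e := by
  have h1 := mul_idempotent_of_inverse h he hf
  have h2 := mul_idempotent_of_inverse h hf he
  exact (h (e * f)).unique (isSemigroupInverse_self h1) ⟨by grind, by grind⟩

theorem IsSemigroupInverse.mul (h : ∀ a : S, ∃! b : S, IsSemigroupInverse a b) {a b a' b' : S}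
    (ha : IsSemigroupInverse a a') (hb : IsSemigroupInverse b b') :
    IsSemigroupInverse (a * b) (b' * a') := by
  obtain ⟨ha1, ha2⟩ := ha
  obtain ⟨hb1, hb2⟩ := hb
  have hc : (a' * a) * (b * b') = (b * b') * (a' * a) :=
    idempotent_comm_of_inverse h (by grind) (by grind)
  exact ⟨by grind, by grind⟩

/-- A semigroup in which every element has an inverse and idempotents commute is inverse. -/
theorem existsUnique_inverse_of_idempotent_comm (h : ∀ a : S, ∃ b : S, IsSemigroupInverse a b)
    (hc : ∀ e f : S, e * e = e → f * f = f → e * f = f * e) (a : S) :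
    ∃! b : S, IsSemigroupInverse a b := by
  obtain ⟨b, hb⟩ := h a
  refine ⟨b, hb, ?_⟩
  rintro c ⟨hc1, hc2⟩
  obtain ⟨hb1, hb2⟩ := hb
  -- Since `a * b * a = a = a * c * a`, the two sides collapse to `a * c` and `a * b`.
  have h1 : (a * b) * (a * c) = (a * c) * (a * b) := hc _ _ (by grind) (by grind)
  have h2 : (b * a) * (c * a) = (c * a) * (b * a) := hc _ _ (by grind) (by grind)
  have h3 : a * c = a * b := by grind
  have h4 : c * a = b * a := by grind
  calc c = c * a * c := hc2
    _ = b * a * b := by rw [h4, mul_assoc, h3, ← mul_assoc]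
    _ = b := hb2.symm

/-- The restricted product of an inverse semigroup: `s · t` is defined, and equal to `s * t`,
when `s * t * t' = s`. -/
def restrictedMul (s t : S) : Part S :=
  ⟨∃ t' : S, IsSemigroupInverse t t' ∧ s * t * t' = s, fun _ => s * t⟩

theorem mem_restrictedMul {s t z : S} : z ∈ restrictedMul s t ↔
    z = s * t ∧ ∃ t' : S, IsSemigroupInverse t t' ∧ s * t * t' = s :=
  ⟨fun ⟨h, e⟩ => ⟨e.symm, h⟩, fun ⟨e, h⟩ => ⟨h, e.symm⟩⟩

theorem mem_restrictedMul_idempotent {x e z : S} (h : ∀ a : S, ∃! b : S, IsSemigroupInverse a b)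
    (he : e * e = e) : z ∈ restrictedMul x e ↔ z = x ∧ x * e = x := by
  rw [mem_restrictedMul]
  constructor
  · rintro ⟨rfl, t, ht, h1⟩
    obtain rfl := (h e).unique ht (isSemigroupInverse_self he)
    grind
  · rintro ⟨rfl, h1⟩
    exact ⟨h1.symm, e, isSemigroupInverse_self he, by rw [h1, h1]⟩

theorem isRightIdentity_restrictedMul (h : ∀ a : S, ∃! b : S, IsSemigroupInverse a b) {e : S} :
    IsRightIdentity restrictedMul e ↔ e * e = e := by
  constructor
  · intro he
    obtain ⟨f, hf, -⟩ := h e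
    -- `(e * f) · e` is defined with value `e`, so the right identity law forces `e = e * f`.
    have h1 := he (e * f) (e * f * e) (mem_restrictedMul.2 ⟨rfl, f, hf, by rw [← hf.1]⟩)
    rw [← hf.1] at h1
    have h2 := hf.1
    rw [← h1] at h2
    exact h2.symm
  · intro he x z hz
    exact ((mem_restrictedMul_idempotent h he).1 hz).1

/-- The constellation of an inverse semigroup. -/
@[reducible]
def constellationOfInverse (h : ∀ a : S, ∃! b : S, IsSemigroupInverse a b) :
    Constellation S where
  mul := restrictedMul
  const1 x y z a w ha hw := by
    rw [mem_restrictedMul] at ha hw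
    obtain ⟨rfl, z', hz, h1⟩ := ha
    obtain ⟨rfl, w', hw, h2⟩ := hw
    obtain ⟨y', hy, -⟩ := h y
    obtain rfl := (h _).unique hw (hy.mul h hz)
    have h3 : x * y * y' = x := by grind
    have h4 : x * y * z * z' = x * y := by grind
    exact ⟨x * y, mem_restrictedMul.2 ⟨rfl, y', hy, h3⟩,
      mem_restrictedMul.2 ⟨(mul_assoc _ _ _).symm, z', hz, h4⟩⟩
  const2 x y z a b ha hb := by
    rw [mem_restrictedMul] at ha hb
    obtain ⟨rfl, y', hy, h1⟩ := ha
    obtain ⟨rfl, z', hz, h2⟩ := hb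
    exact ⟨z' * y', hy.mul h hz, by grind⟩
  const3 x := by
    obtain ⟨y, hy, -⟩ := h x
    have hi : x * y * (x * y) = x * y := by rw [← mul_assoc, ← hy.1]
    refine ⟨x * y, ⟨(isRightIdentity_restrictedMul h).2 hi,
      mem_restrictedMul.2 ⟨hy.1, y, hy, by grind⟩⟩, ?_⟩
    rintro e ⟨he, hx⟩
    rw [isRightIdentity_restrictedMul h] at he
    rw [mem_restrictedMul] at hx
    obtain ⟨h1, z, hz, h2⟩ := hx
    obtain rfl := (h x).unique hz hy
    rw [← h1] at h2
    exact h2.symm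

end InverseSemigroup

/-! ### Projections, D-inverses and meets in the constellation of an inverse semigroup. -/

namespace Constellation

section OfInverse

variable {S : Type u} [Semigroup S] (h : ∀ a : S, ∃! b : S, IsSemigroupInverse a b)

theorem D_ofInverse {a b : S} (hab : IsSemigroupInverse a b) :
    letI := constellationOfInverse h
    D a = a * b := by
  let := constellationOfInverse h
  have hi : a * b * (a * b) = a * b := by rw [← mul_assoc, ← hab.1]
  exact (eq_D a (a * b) ((isRightIdentity_restrictedMul h).2 hi)
    (mem_restrictedMul.2 ⟨hab.1, b, hab, by grind⟩)).symm

theorem mem_projections_ofInverse {e : S} :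
    letI := constellationOfInverse h
    e ∈ projections S ↔ e * e = e := by
  let := constellationOfInverse h
  constructor
  · rintro ⟨x, rfl⟩
    exact (isRightIdentity_restrictedMul h).1 (D_spec x).1
  · intro he
    exact ⟨e, by rw [D_ofInverse h (isSemigroupInverse_self he), he]⟩

theorem naturalLE_ofInverse {e f : S} (he : e * e = e) (hf : f * f = f) :
    letI := constellationOfInverse h
    NaturalLE e f ↔ e * f = e := by
  let := constellationOfInverse h
  constructor
  · rintro ⟨g, -, hg⟩
    obtain ⟨rfl, h1⟩ := (mem_restrictedMul_idempotent h hf).1 hg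
    exact h1
  · intro h1
    exact ⟨e, (mem_projections_ofInverse h).2 he, (mem_restrictedMul_idempotent h hf).2 ⟨rfl, h1⟩⟩

theorem isDInverse_ofInverse {a b : S} :
    letI := constellationOfInverse h
    IsDInverse a b ↔ IsSemigroupInverse a b := by
  let := constellationOfInverse h
  obtain ⟨a', ha, -⟩ := h a
  obtain ⟨b', hb, -⟩ := h b
  constructor
  · rintro ⟨h1, h2⟩
    rw [D_ofInverse h ha] at h1
    rw [D_ofInverse h hb] at h2
    obtain ⟨h1, c, hc, h3⟩ := mem_restrictedMul.1 h1
    obtain ⟨h2, d, hd, h4⟩ := mem_restrictedMul.1 h2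
    have h5 := ha.1
    have h6 := hb.1
    exact ⟨by grind, by grind⟩
  · intro hab
    rw [IsDInverse, D_ofInverse h hab, D_ofInverse h hab.symm]
    exact ⟨mem_restrictedMul.2 ⟨rfl, a, hab.symm, hab.1.symm⟩,
      mem_restrictedMul.2 ⟨rfl, b, hab, hab.2.symm⟩⟩

theorem dInverse_ofInverse :
    letI := constellationOfInverse h
    DInverse S := by
  let := constellationOfInverse h
  intro s
  simp only [isDInverse_ofInverse h]
  exact h s

theorem isMeet_ofInverse {e f : S} (he : e * e = e) (hf : f * f = f) :
    letI := constellationOfInverse h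
    IsMeet e f (e * f) := by
  let := constellationOfInverse h
  have hc := idempotent_comm_of_inverse h he hf
  have hi := mul_idempotent_of_inverse h he hf
  refine ⟨(mem_projections_ofInverse h).2 hi, (naturalLE_ofInverse h hi he).2 (by grind),
    (naturalLE_ofInverse h hi hf).2 (by grind), ?_⟩
  intro g hg h1 h2
  rw [mem_projections_ofInverse h] at hg
  rw [naturalLE_ofInverse h hg he] at h1
  rw [naturalLE_ofInverse h hg hf] at h2
  rw [naturalLE_ofInverse h hg hi]
  rw [← mul_assoc, h1, h2]

theorem projectionsMeetSemilattice_ofInverse :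
    letI := constellationOfInverse h
    ProjectionsMeetSemilattice S := by
  let := constellationOfInverse h
  have hp (e : projections S) : e.1 * e.1 = e.1 := (mem_projections_ofInverse h).1 e.2
  have hm (e f : projections S) := isMeet_ofInverse h (hp e) (hp f)
  refine ⟨{ le := fun e f => NaturalLE e.1 f.1
            le_refl := fun e => (naturalLE_ofInverse h (hp e) (hp e)).2 (hp e)
            le_trans := fun e f g h1 h2 => ?_
            le_antisymm := fun e f h1 h2 => ?_
            inf := fun e f => ⟨e.1 * f.1, (hm e f).1⟩
            inf_le_left := fun e f => (hm e f).2.1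
            inf_le_right := fun e f => (hm e f).2.2.1
            le_inf := fun e f g h1 h2 => (hm f g).2.2.2 e.1 e.2 h1 h2 }, fun e f => Iff.rfl⟩
  · rw [naturalLE_ofInverse h (hp e) (hp f)] at h1
    rw [naturalLE_ofInverse h (hp f) (hp g)] at h2
    rw [naturalLE_ofInverse h (hp e) (hp g)]
    rw [← h1, mul_assoc, h2]
  · rw [naturalLE_ofInverse h (hp e) (hp f)] at h1
    rw [naturalLE_ofInverse h (hp f) (hp e)] at h2
    exact Subtype.ext (by rw [← h1, idempotent_comm_of_inverse h (hp e) (hp f), h2])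

end OfInverse

end Constellation

/-! ### Calculus of partial products, and products characterised by their action. -/

namespace Constellation

section Calculus

variable {Q : Type u} [Constellation Q]

theorem mem_mul_D {x y z : Q} : z ∈ mul x (D y) → z = x := (D_spec y).1 x z

/-- With `exists_mem_of_mem_mul_D`, this shows that definedness of `x · y` depends on `y` only
through `D y`. -/
theorem mem_mul_D_of_mem {x y z : Q} (h : z ∈ mul x y) : x ∈ mul x (D y) := by
  obtain ⟨b, hb, -⟩ := const1 x (D y) y y z (D_spec y).2 h
  rwa [mem_mul_D hb] at hb

theorem assoc_left {x y z a w : Q} (ha : a ∈ mul y z) (hw : w ∈ mul x a) :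
    ∃ b, b ∈ mul x y ∧ w ∈ mul b z := const1 x y z a w ha hw

theorem assoc_right {x y z a b w : Q} (ha : a ∈ mul x y) (hb : b ∈ mul y z) (hw : w ∈ mul a z) :
    w ∈ mul x b := by
  have hd := const2 x y z a b ha hb
  obtain ⟨c, hc, h1⟩ := const1 x y z b _ hb (Part.get_mem hd)
  rw [Part.mem_unique hc ha] at h1
  rw [Part.mem_unique hw h1]
  exact Part.get_mem hd

theorem exists_mem_of_mem_mem {x y z a b : Q} (ha : a ∈ mul x y) (hb : b ∈ mul y z) :
    ∃ w, w ∈ mul x b ∧ w ∈ mul a z := by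
  have hd := const2 x y z a b ha hb
  obtain ⟨c, hc, h1⟩ := const1 x y z b _ hb (Part.get_mem hd)
  rw [Part.mem_unique hc ha] at h1
  exact ⟨_, Part.get_mem hd, h1⟩

theorem exists_mem_of_mem_mul_D {x y : Q} (h : x ∈ mul x (D y)) : ∃ w, w ∈ mul x y := by
  obtain ⟨w, hw, -⟩ := exists_mem_of_mem_mem h (D_spec y).2
  exact ⟨w, hw⟩

theorem mem_D_D (x : Q) : D x ∈ mul (D x) (D x) := mem_mul_D_of_mem (D_spec x).2

theorem D_D (x : Q) : D (D x) = D x := (eq_D _ _ (D_spec x).1 (mem_D_D x)).symm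

theorem D_of_mem_projections {e : Q} (h : e ∈ projections Q) : D e = e := by
  obtain ⟨x, rfl⟩ := h
  exact D_D x

theorem D_mem_projections (x : Q) : D x ∈ projections Q := ⟨x, rfl⟩

theorem D_mul {x y z : Q} (h : z ∈ mul x y) : D z = D x := by
  obtain ⟨w, h1, h2⟩ := exists_mem_of_mem_mem (D_spec x).2 h
  rw [Part.mem_unique h2 h] at h1
  exact (eq_D z (D x) (D_spec x).1 h1).symm

theorem mem_mul_projection {x e z : Q} (he : e ∈ projections Q) (h : z ∈ mul x e) : z = x := by
  obtain ⟨y, rfl⟩ := he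
  exact mem_mul_D h

theorem naturalLE_projection_iff {e f : Q} (hf : f ∈ projections Q) (he : e ∈ projections Q) :
    NaturalLE e f ↔ e ∈ mul e f := by
  constructor
  · rintro ⟨g, hg, h⟩
    obtain rfl := mem_mul_projection hf h
    exact h
  · intro h
    exact ⟨e, he, h⟩

theorem IsDInverse.symm {s t : Q} (h : IsDInverse s t) : IsDInverse t s := ⟨h.2, h.1⟩

theorem IsDInverse.mem_mul_D {s t : Q} (h : IsDInverse s t) : s ∈ mul s (D t) :=
  mem_mul_D_of_mem h.1

/-- `z` represents the composite of right multiplication by `s` and right multiplication by `t`. -/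
def IsProduct (s t z : Q) : Prop :=
  ∀ x w : Q, w ∈ mul x z ↔ ∃ y, y ∈ mul x s ∧ w ∈ mul y t

/-- Right multiplication by an element, as a partial map, is determined on the projections. -/
theorem eq_of_mul_eq {s t : Q}
    (ha : ∀ e f : Q, e ∈ projections Q → f ∈ projections Q → e ∈ mul e f → f ∈ mul f e → e = f)
    (h : ∀ x w : Q, w ∈ mul x s ↔ w ∈ mul x t) : s = t := by
  -- Evaluating both actions at `D s` and at `D t` gives `D s ≤ D t` and `D t ≤ D s`.
  have h1 : s ∈ mul (D s) t := (h _ _).1 (D_spec s).2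
  have h2 : t ∈ mul (D t) s := (h _ _).2 (D_spec t).2
  have h3 : D s = D t := ha _ _ (D_mem_projections s) (D_mem_projections t)
    (mem_mul_D_of_mem h1) (mem_mul_D_of_mem h2)
  rw [h3] at h1
  exact Part.mem_unique h1 (D_spec t).2

theorem ProjectionsMeetSemilattice.antisymm (hM : ProjectionsMeetSemilattice Q) {e f : Q}
    (he : e ∈ projections Q) (hf : f ∈ projections Q) (h1 : e ∈ mul e f) (h2 : f ∈ mul f e) :
    e = f := by
  obtain ⟨L, hL⟩ := hM
  exact congrArg Subtype.val (L.le_antisymm ⟨e, he⟩ ⟨f, hf⟩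
    ((hL _ _).2 ((naturalLE_projection_iff hf he).2 h1))
    ((hL _ _).2 ((naturalLE_projection_iff he hf).2 h2)))

theorem IsMeet.unique (hM : ProjectionsMeetSemilattice Q) {e f g g' : Q} (h : IsMeet e f g)
    (h' : IsMeet e f g') : g = g' :=
  hM.antisymm h.1 h'.1
    ((naturalLE_projection_iff h'.1 h.1).1 (h'.2.2.2 _ h.1 h.2.1 h.2.2.1))
    ((naturalLE_projection_iff h.1 h'.1).1 (h.2.2.2 _ h'.1 h'.2.1 h'.2.2.1))

theorem ProjectionsMeetSemilattice.exists_isMeet (hM : ProjectionsMeetSemilattice Q) {e f : Q}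
    (he : e ∈ projections Q) (hf : f ∈ projections Q) : ∃ g, IsMeet e f g := by
  obtain ⟨L, hL⟩ := hM
  refine ⟨(L.inf ⟨e, he⟩ ⟨f, hf⟩).1, Subtype.property _, (hL _ ⟨e, he⟩).1 (L.inf_le_left _ _),
    (hL _ ⟨f, hf⟩).1 (L.inf_le_right _ _), ?_⟩
  intro h hh h1 h2
  exact (hL ⟨h, hh⟩ _).1 (L.le_inf _ _ _ ((hL _ _).2 h1) ((hL _ _).2 h2))

theorem ProjectionsMeetSemilattice.eq_of_mul_eq (hM : ProjectionsMeetSemilattice Q) {s t : Q}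
    (h : ∀ x w : Q, w ∈ mul x s ↔ w ∈ mul x t) : s = t :=
  Constellation.eq_of_mul_eq (fun _ _ he hf h1 h2 => hM.antisymm he hf h1 h2) h

theorem IsProduct.unique (hM : ProjectionsMeetSemilattice Q) {s t z z' : Q}
    (h : IsProduct s t z) (h' : IsProduct s t z') : z = z' :=
  hM.eq_of_mul_eq fun x w => (h x w).trans (h' x w).symm

theorem isProduct_of_mem {s t z : Q} (h : z ∈ mul s t) : IsProduct s t z := fun _ _ =>
  ⟨fun hw => assoc_left h hw, fun ⟨_, hy, hw⟩ => assoc_right hy h hw⟩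

theorem IsProduct.mem {s t z : Q} (h : IsProduct s t z) (hs : s ∈ mul s (D t))
    (hM : ProjectionsMeetSemilattice Q) : z ∈ mul s t := by
  obtain ⟨w, hw⟩ := exists_mem_of_mem_mul_D hs
  rwa [h.unique hM (isProduct_of_mem hw)]

/-- `z` is the product `v · t`, where `v` is the corestriction of `s` to the meet of the range
of `s` with the domain of `t`. -/
def IsRestrictedProduct (s t z : Q) : Prop :=
  ∃ s' g u v : Q, IsDInverse s s' ∧ IsMeet (D s') (D t) g ∧ u ∈ mul g s' ∧ IsDInverse u v ∧
    z ∈ mul v t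

theorem exists_isRestrictedProduct (hD : DInverse Q) (hM : ProjectionsMeetSemilattice Q)
    (s t : Q) : ∃ z, IsRestrictedProduct s t z := by
  obtain ⟨s', hs, -⟩ := hD s
  obtain ⟨g, hg⟩ := hM.exists_isMeet (D_mem_projections s') (D_mem_projections t)
  obtain ⟨hgp, h1, h2, -⟩ := id hg
  rw [naturalLE_projection_iff (D_mem_projections _) hgp] at h1 h2
  obtain ⟨u, hu⟩ := exists_mem_of_mem_mul_D h1
  obtain ⟨v, hv, -⟩ := hD u
  have hDu : D u = g := by rw [D_mul hu, D_of_mem_projections hgp]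
  have hvg : v ∈ mul v g := hDu ▸ hv.symm.mem_mul_D
  obtain ⟨w, -, hw⟩ := exists_mem_of_mem_mem hvg h2
  obtain rfl := mem_mul_D hw
  obtain ⟨z, hz⟩ := exists_mem_of_mem_mul_D hw
  exact ⟨z, s', g, u, w, hs, hg, hu, hv, hz⟩

/-- As `v = D v · s`, acting by `v` agrees with acting by `s` wherever it is defined. Conversely, if
`y = x · s` and `y · t` exist, the range of `y` lies below both `D s'` and `D t`, hence below their
meet `g`, so `y` is already reached as `x · v`. -/
theorem IsRestrictedProduct.isProduct (hD : DInverse Q) {s t z : Q}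
    (h : IsRestrictedProduct s t z) : IsProduct s t z := by
  obtain ⟨s', g, u, v, hs, ⟨hgp, hg1, hg2, hg⟩, hu, hv, hz⟩ := h
  rw [naturalLE_projection_iff (D_mem_projections _) hgp] at hg1 hg2
  have hDu : D u = g := by rw [D_mul hu, D_of_mem_projections hgp]
  have huv : g ∈ mul u v := hDu ▸ hv.1
  have hvg : v ∈ mul v g := hDu ▸ hv.symm.mem_mul_D
  have hus : g ∈ mul u s := by
    obtain ⟨w, h1, h2⟩ := exists_mem_of_mem_mem hu hs.2
    rwa [mem_mul_D h1] at h2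
  have hvs : v ∈ mul (D v) s := by
    obtain ⟨w, h1, h2⟩ := exists_mem_of_mem_mem hv.2 hus
    rwa [mem_mul_projection hgp h1] at h2
  intro x w
  constructor
  · intro hw
    obtain ⟨y, hy, hyt⟩ := assoc_left hz hw
    obtain ⟨x', hx', hys⟩ := assoc_left hvs hy
    rw [mem_mul_D hx'] at hys
    exact ⟨y, hys, hyt⟩
  · rintro ⟨y, hy, hw⟩
    have hys' : x ∈ mul y s' := by
      obtain ⟨x', h1, h2⟩ := exists_mem_of_mem_mem hy hs.1
      rwa [mem_mul_D h1] at h2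
    -- `D y'` is the range of `y`: it lies below each projection that fixes `y` on the right.
    obtain ⟨y', hyy, -⟩ := hD y
    have hle (e : Q) (he : e ∈ projections Q) (hye : y ∈ mul y e) : NaturalLE (D y') e := by
      rw [naturalLE_projection_iff he (D_mem_projections _)]
      obtain ⟨c, h1, h2⟩ := exists_mem_of_mem_mem hyy.2 hye
      rwa [mem_mul_projection he h2] at h2
    have hyg : y ∈ mul y g := by
      have h1 := hg _ (D_mem_projections y') (hle _ (D_mem_projections _) (mem_mul_D_of_mem hys'))
        (hle _ (D_mem_projections _) (mem_mul_D_of_mem hw))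
      rw [naturalLE_projection_iff hgp (D_mem_projections _)] at h1
      obtain ⟨c, h2, h3⟩ := exists_mem_of_mem_mem hyy.mem_mul_D h1
      rwa [mem_mul_projection hgp h3] at h3
    have hyu : x ∈ mul y u := assoc_right hyg hu hys'
    have hxv : y ∈ mul x v := by
      obtain ⟨c, h2, h3⟩ := exists_mem_of_mem_mem hyu huv
      rwa [mem_mul_projection hgp h2] at h3
    exact assoc_right hxv hz hw

/-- Unlike `IsProduct`, which quantifies over all `x`, this relation only asserts the existence of
D-inverses, a meet and defined products, all of which are preserved. -/
theorem MeetRadiant.map_isRestrictedProduct {P : Type u} [Constellation P]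
    (ρ : MeetRadiant P Q) {s t z : P} (h : IsRestrictedProduct s t z) :
    IsRestrictedProduct (ρ.toFun s) (ρ.toFun t) (ρ.toFun z) := by
  obtain ⟨s', g, u, v, hs, hg, hu, hv, hz⟩ := h
  have hi {a b : P} (hab : IsDInverse a b) : IsDInverse (ρ.toFun a) (ρ.toFun b) := by
    rw [IsDInverse, ρ.map_D', ρ.map_D']
    exact ⟨ρ.map_mul' _ _ _ hab.1, ρ.map_mul' _ _ _ hab.2⟩
  refine ⟨ρ.toFun s', ρ.toFun g, ρ.toFun u, ρ.toFun v, hi hs, ?_, ρ.map_mul' _ _ _ hu, hi hv,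
    ρ.map_mul' _ _ _ hz⟩
  rw [ρ.map_D', ρ.map_D']
  exact ρ.map_meet' _ (D_mem_projections _) _ (D_mem_projections _) _ hg

end Calculus

/-! ### The inverse semigroup of a constellation. -/

section Semigroup

variable {Q : Type u} [Constellation Q] (hD : DInverse Q) (hM : ProjectionsMeetSemilattice Q)

/-- The everywhere defined product of a D-inverse constellation whose projections form a
meet-semilattice. -/
noncomputable def totalMul (s t : Q) : Q := (exists_isRestrictedProduct hD hM s t).choose

theorem isRestrictedProduct_totalMul (s t : Q) : IsRestrictedProduct s t (totalMul hD hM s t) :=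
  (exists_isRestrictedProduct hD hM s t).choose_spec

theorem isProduct_totalMul (s t : Q) : IsProduct s t (totalMul hD hM s t) :=
  (isRestrictedProduct_totalMul hD hM s t).isProduct hD

/-- The semigroup of a D-inverse constellation whose projections form a meet-semilattice. -/
@[reducible]
noncomputable def semigroupOfDInverse : Semigroup Q where
  mul := totalMul hD hM
  mul_assoc a b c := by
    refine hM.eq_of_mul_eq fun x w => ?_
    refine (isProduct_totalMul hD hM _ c x w).trans
      (Iff.trans ?_ (isProduct_totalMul hD hM a _ x w).symm)
    constructor
    · rintro ⟨y, h1, h2⟩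
      obtain ⟨y', h3, h4⟩ := (isProduct_totalMul hD hM a b x y).1 h1
      exact ⟨y', h3, (isProduct_totalMul hD hM b c y' w).2 ⟨y, h4, h2⟩⟩
    · rintro ⟨y', h1, h2⟩
      obtain ⟨y, h3, h4⟩ := (isProduct_totalMul hD hM b c y' w).1 h2
      exact ⟨y, (isProduct_totalMul hD hM a b x y).2 ⟨y', h1, h3⟩, h4⟩

theorem mul_eq_of_isProduct {s t z : Q} (h : IsProduct s t z) :
    letI := semigroupOfDInverse hD hM
    s * t = z :=
  (isProduct_totalMul hD hM s t).unique hM h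

theorem mul_eq_of_mem {s t z : Q} (h : z ∈ mul s t) :
    letI := semigroupOfDInverse hD hM
    s * t = z :=
  mul_eq_of_isProduct hD hM (isProduct_of_mem h)

theorem IsDInverse.isSemigroupInverse {s t : Q} (h : IsDInverse s t) :
    letI := semigroupOfDInverse hD hM
    IsSemigroupInverse s t := by
  let := semigroupOfDInverse hD hM
  constructor
  · rw [mul_eq_of_mem hD hM h.1, mul_eq_of_mem hD hM (D_spec s).2]
  · rw [mul_eq_of_mem hD hM h.2, mul_eq_of_mem hD hM (D_spec t).2]

theorem mem_projections_of_idempotent {e : Q}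
    (he : letI := semigroupOfDInverse hD hM; e * e = e) : e ∈ projections Q := by
  let := semigroupOfDInverse hD hM
  have hp : IsProduct e e e := by
    have := isProduct_totalMul hD hM e e
    rwa [show totalMul hD hM e e = e from he] at this
  -- Acting on `D e` shows that `e · e = e` already in the constellation; multiplying by the
  -- D-inverse of `e` then gives `e = D e`.
  obtain ⟨y, h1, h2⟩ := (hp (D e) e).1 (D_spec e).2
  rw [Part.mem_unique h1 (D_spec e).2] at h2
  obtain ⟨f, hf, -⟩ := hD e
  obtain ⟨a, h3, h4⟩ := exists_mem_of_mem_mem h2 hf.1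
  rw [← mem_mul_D h3, Part.mem_unique h4 hf.1]
  exact D_mem_projections _

/-- A projection acts as a restriction of the identity map, and such partial maps commute. -/
theorem projection_mul_comm {e f : Q} (he : e ∈ projections Q) (hf : f ∈ projections Q) :
    letI := semigroupOfDInverse hD hM
    e * f = f * e := by
  refine mul_eq_of_isProduct hD hM fun x w => ?_
  refine (isProduct_totalMul hD hM f e x w).trans ?_
  constructor
  · rintro ⟨y, h1, h2⟩
    obtain rfl := mem_mul_projection he h2
    obtain rfl := mem_mul_projection hf h1
    exact ⟨w, h2, h1⟩
  · rintro ⟨y, h1, h2⟩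
    obtain rfl := mem_mul_projection hf h2
    obtain rfl := mem_mul_projection he h1
    exact ⟨w, h2, h1⟩

theorem existsUnique_isSemigroupInverse :
    letI := semigroupOfDInverse hD hM
    ∀ a : Q, ∃! b : Q, IsSemigroupInverse a b := by
  let := semigroupOfDInverse hD hM
  refine existsUnique_inverse_of_idempotent_comm
    (fun a => (hD a).exists.imp fun b hb => hb.isSemigroupInverse hD hM) fun e f he hf => ?_
  exact projection_mul_comm hD hM (mem_projections_of_idempotent hD hM he)
    (mem_projections_of_idempotent hD hM hf)

theorem constellationOfInverse_semigroupOfDInverse :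
    letI := semigroupOfDInverse hD hM
    constellationOfInverse (existsUnique_isSemigroupInverse hD hM) = ‹Constellation Q› := by
  let := semigroupOfDInverse hD hM
  have h := existsUnique_isSemigroupInverse hD hM
  refine Constellation.ext (funext₂ fun s t => Part.ext fun z => ?_)
  refine mem_restrictedMul.trans ?_
  obtain ⟨t', ht, -⟩ := hD t
  have hs : s * t * t' = s * D t := by rw [mul_assoc, mul_eq_of_mem hD hM ht.1]
  constructor
  · rintro ⟨rfl, t'', ht'', h1⟩
    obtain rfl := (h t).unique ht'' (ht.isSemigroupInverse hD hM)
    have h2 := isProduct_totalMul hD hM s (D t)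
    rw [show totalMul hD hM s (D t) = s from hs.symm.trans h1] at h2
    -- The total equation `s * D t = s`, evaluated at `D s`, forces the partial product `s · D t` to
    -- exist.
    obtain ⟨y, h3, h4⟩ := (h2 (D s) s).1 (D_spec s).2
    rw [Part.mem_unique h3 (D_spec s).2] at h4
    exact (isProduct_totalMul hD hM s t).mem h4 hM
  · intro hz
    refine ⟨(mul_eq_of_mem hD hM hz).symm, t', ht.isSemigroupInverse hD hM, ?_⟩
    rw [hs, mul_eq_of_mem hD hM (mem_mul_D_of_mem hz)]

end Semigroup

/-! ### Recovering the semigroup and its morphisms from the constellation. -/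

section OfInverse

variable {S : Type u} [Semigroup S] (h : ∀ a : S, ∃! b : S, IsSemigroupInverse a b)

theorem isProduct_ofInverse (s t : S) :
    letI := constellationOfInverse h
    IsProduct s t (s * t) := by
  let := constellationOfInverse h
  obtain ⟨s', hs, -⟩ := h s
  obtain ⟨t', ht, -⟩ := h t
  intro x w
  constructor
  · intro hw
    obtain ⟨rfl, u, hu, h1⟩ := mem_restrictedMul.1 hw
    obtain rfl := (h _).unique hu (hs.mul h ht)
    have h2 := hs.1
    have h3 := ht.1
    -- This commutation splits the condition `x * (s * t) * (t' * s') = x` into the definedness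
    -- conditions for `x · s` and `(x · s) · t`.
    have h4 : (t * t') * (s' * s) = (s' * s) * (t * t') :=
      idempotent_comm_of_inverse h (by grind) (by grind)
    exact ⟨x * s, mem_restrictedMul.2 ⟨rfl, s', hs, by grind⟩,
      mem_restrictedMul.2 ⟨by grind, t', ht, by grind⟩⟩
  · rintro ⟨y, hy, hw⟩
    obtain ⟨rfl, u, hu, h1⟩ := mem_restrictedMul.1 hy
    obtain ⟨rfl, v, hv, h2⟩ := mem_restrictedMul.1 hw
    exact mem_restrictedMul.2 ⟨by grind, v * u, hu.mul h hv, by grind⟩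

theorem isRestrictedProduct_ofInverse (s t : S) :
    letI := constellationOfInverse h
    IsRestrictedProduct s t (s * t) := by
  let := constellationOfInverse h
  have hD := dInverse_ofInverse h
  have hM := projectionsMeetSemilattice_ofInverse h
  obtain ⟨z, hz⟩ := exists_isRestrictedProduct hD hM s t
  rwa [(isProduct_ofInverse h s t).unique hM (hz.isProduct hD)]

theorem MeetRadiant.map_mul_ofInverse {T : Type u} [Semigroup T]
    (k : ∀ a : T, ∃! b : T, IsSemigroupInverse a b) :
    letI := constellationOfInverse h
    letI := constellationOfInverse k
    ∀ (ρ : MeetRadiant S T) (s t : S), ρ.toFun (s * t) = ρ.toFun s * ρ.toFun t := by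
  let := constellationOfInverse h
  let := constellationOfInverse k
  intro ρ s t
  have h1 := ρ.map_isRestrictedProduct (isRestrictedProduct_ofInverse h s t)
  exact (h1.isProduct (dInverse_ofInverse k)).unique (projectionsMeetSemilattice_ofInverse k)
    (isProduct_ofInverse k _ _)

/-- A morphism of inverse semigroups is a meet-preserving radiant of their constellations. -/
@[reducible]
def meetRadiantOfMulHom {T : Type u} [Semigroup T]
    (k : ∀ a : T, ∃! b : T, IsSemigroupInverse a b) (f : S →ₙ* T) :
    letI := constellationOfInverse h
    letI := constellationOfInverse k
    MeetRadiant S T :=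
  letI := constellationOfInverse h
  letI := constellationOfInverse k
  have hinv {a b : S} (hab : IsSemigroupInverse a b) : IsSemigroupInverse (f a) (f b) := by
    constructor
    · rw [← map_mul, ← map_mul, ← hab.1]
    · rw [← map_mul, ← map_mul, ← hab.2]
  { toFun := f
    map_mul' := fun s t z hz => by
      obtain ⟨rfl, t', ht, h1⟩ := mem_restrictedMul.1 hz
      exact mem_restrictedMul.2
        ⟨map_mul f s t, f t', hinv ht, by rw [← map_mul, ← map_mul, h1]⟩
    map_D' := fun s => by
      let := constellationOfInverse h
      let := constellationOfInverse k
      obtain ⟨s', hs, -⟩ := h s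
      rw [D_ofInverse h hs, D_ofInverse k (hinv hs), map_mul]
    map_meet' := fun e he f' hf g hg => by
      rw [mem_projections_ofInverse h] at he hf
      rw [@IsMeet.unique S (constellationOfInverse h) (projectionsMeetSemilattice_ofInverse h)
        _ _ _ _ hg (isMeet_ofInverse h he hf), map_mul]
      exact isMeet_ofInverse k (by rw [← map_mul, he]) (by rw [← map_mul, hf]) }

end OfInverse

/-- An inverse semigroup is determined by its constellation. -/
theorem semigroup_eq_of_constellationOfInverse_eq {S : Type u} (m₁ m₂ : Semigroup S)
    (h₁ : letI := m₁; ∀ a : S, ∃! b : S, IsSemigroupInverse a b)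
    (h₂ : letI := m₂; ∀ a : S, ∃! b : S, IsSemigroupInverse a b)
    (h : @constellationOfInverse S m₁ h₁ = @constellationOfInverse S m₂ h₂) : m₁ = m₂ := by
  refine Semigroup.ext (funext₂ fun s t => ?_)
  have h2 := @isProduct_ofInverse S m₂ h₂ s t
  rw [← h] at h2
  exact @IsProduct.unique S (@constellationOfInverse S m₁ h₁)
    (@projectionsMeetSemilattice_ofInverse S m₁ h₁) _ _ _ _ (@isProduct_ofInverse S m₁ h₁ s t) h2

end Constellation

/-! ### The isomorphism of categories. -/

theorem MeetDInvConst.eq_of_str_eq {Q : Type u} {c d : Constellation Q} (h : c = d)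
    (hc : @Constellation.DInverse Q c) (hc' : @Constellation.ProjectionsMeetSemilattice Q c)
    (hd : @Constellation.DInverse Q d) (hd' : @Constellation.ProjectionsMeetSemilattice Q d) :
    @MeetDInvConst.mk Q c hc hc' = @MeetDInvConst.mk Q d hd hd' := by
  subst h
  rfl

/-- The functor sending an inverse semigroup to its constellation. -/
def inverseSemigroupToConstellation : InvSemigrp.{u} ⥤ MeetDInvConst.{u} where
  obj S :=
    { carrier := S.obj.carrier
      str := constellationOfInverse S.property
      dInverse := Constellation.dInverse_ofInverse S.property
      meets := Constellation.projectionsMeetSemilattice_ofInverse S.property }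
  map {S T} f := ⟨Constellation.meetRadiantOfMulHom S.property T.property f.hom.hom⟩

instance : inverseSemigroupToConstellation.{u}.IsIso where
  faithful :=
    { map_injective := fun {S T f g} hfg => by
        apply ObjectProperty.hom_ext
        ext x
        exact congrArg (fun ρ => ρ.hom.toFun x) hfg }
  full :=
    { map_surjective := fun {S T} ρ =>
        ⟨ObjectProperty.homMk (Semigrp.ofHom ⟨ρ.hom.toFun,
          Constellation.MeetRadiant.map_mul_ofInverse S.property T.property ρ.hom⟩), rfl⟩ }
  bijective_obj := by
    constructor
    · rintro ⟨@⟨S, m₁⟩, h₁⟩ ⟨@⟨T, m₂⟩, h₂⟩ h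
      obtain ⟨hc, hs⟩ := MeetDInvConst.mk.inj h
      obtain rfl : S = T := hc
      obtain rfl := Constellation.semigroup_eq_of_constellationOfInverse_eq m₁ m₂ h₁ h₂
        (eq_of_heq hs)
      rfl
    · rintro @⟨Q, d, hD, hM⟩
      refine ⟨⟨@Semigrp.of Q (Constellation.semigroupOfDInverse hD hM),
        Constellation.existsUnique_isSemigroupInverse hD hM⟩, ?_⟩
      have hc := Constellation.constellationOfInverse_semigroupOfDInverse hD hM
      exact MeetDInvConst.eq_of_str_eq hc _ _ _ _

theorem mainTheorem2 :
    ∃ Φ : IsoCat MeetDInvConst.{u} InvSemigrp.{u},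
      Φ.inverse ⋙ forget MeetDInvConst.{u} = forget InvSemigrp.{u} ∧
      ∀ S : InvSemigrp.{u}, ∃ (c : Constellation S.obj.carrier)
        (hD : Constellation.DInverse S.obj.carrier)
        (hM : Constellation.ProjectionsMeetSemilattice S.obj.carrier),
        Φ.inverse.obj S = { carrier := S.obj.carrier, str := c, dInverse := hD, meets := hM } ∧
        ∀ s t z : S.obj.carrier, z ∈ c.mul s t ↔
          z = s * t ∧ ∃ t' : S.obj.carrier, IsSemigroupInverse t t' ∧ s * t * t' = s :=
  ⟨inverseSemigroupToConstellation.asIsomorphism.symm, rfl, fun S =>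
    ⟨constellationOfInverse S.property, Constellation.dInverse_ofInverse S.property,
      Constellation.projectionsMeetSemilattice_ofInverse S.property, rfl,
      fun _ _ _ => mem_restrictedMul⟩⟩
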